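/- Let $\mathcal{M}=(S,\mathit{Act},P,s_{\mathit{init}},\mathit{rew})$ be a finite Markov decision process: $S$ and $\mathit{Act}$ are finite, $P:S\times\mathit{Act}\times S\to[0,1]\cap\mathbb{Q}$ with $\sum_{t}P(s,\alpha,t)\in\{0,1\}$ for all $s,\alpha$, $s_{\mathit{init}}\in S$, and $\mathit{rew}:S\times\mathit{Act}\to\mathbb{N}$. Action $\alpha$ is enabled in $s$, written $\alpha\in\mathit{Act}(s)$, if $P(s,\alpha,\cdot)\neq 0$; a trap is a state without enabled actions. A finite path is a sequence $\pi=s_0\,\alpha_0\,s_1\ldots\alpha_{k-1}\,s_k$ with $P(s_i,\alpha_i,s_{i+1})>0$ for all $i<k$; put $\mathit{last}(\pi)=s_k$ and $\mathit{rew}(\pi)=\sum_{i<k}\mathit{rew}(s_i,\alpha_i)$. A maximal path is an infinite path or a finite path that ends in a trap. A scheduler $\mathfrak{S}$ assigns to each finite path $\pi$ whose last state is not a trap a probability distribution on $\mathit{Act}(\mathit{last}(\pi))$. It is deterministic if all these distributions are Dirac, and reward-based if $\mathfrak{S}(\pi)=\mathfrak{S}(\pi')$ whenever $\mathit{last}(\pi)=\mathit{last}(\pi')$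 and $\mathit{rew}(\pi)=\mathit{rew}(\pi')$; a deterministic reward-based scheduler thus amounts to a map $S\times\mathbb{N}\to\mathit{Act}$ that selects enabled actions. Let $\Pr^{\mathfrak{S}}$ be the probability measure induced by $\mathfrak{S}$ on the maximal paths from $s_{\mathit{init}}$. Let $\mathit{goal}$ and $\mathit{fail}$ be trap states such that (A1) for every state $s$: there is no finite path from $s$ to $\mathit{goal}$ if and only if $s=\mathit{fail}$; (A2) $\mathcal{M}$ has no end component, i.e. there is no pair $(E,\mathfrak{A})$ of a nonempty set $E\subseteq S$ and a function $\mathfrak{A}$ assigning to each $s\in E$ a nonempty set $\mathfrak{A}(s)\subseteq\mathit{Act}(s)$ such that $P(s,\alpha,t)>0$ with $s\in E$ and $\alpha\in\mathfrak{A}(s)$ implies $t\in E$, and such that the directed graph induced on $E$ by these transitions is strongly connected. For a scheduler $\mathfrak{S}$ with $\Pr^{\mathfrak{S}}(\Diamond\mathit{goal})>0$, where $\Diamond\mathit{goal}$ is the event that $\mathit{goal}$ is reached, let $\mathrm{CExp}^{\mathfrak{S}}$ be the expectation, with respect to $\Pr^{\mathfrak{S}}(\,\cdot\mid\Diamond\mathit{goal})$,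 of the reward accumulated until $\mathit{goal}$ is reached. Let $\mathrm{CExp}^{\max}=\sup_{\mathfrak{S}}\mathrm{CExp}^{\mathfrak{S}}$, where $\mathfrak{S}$ ranges over all schedulers with $\Pr^{\mathfrak{S}}(\Diamond\mathit{goal})>0$ (and $\sup\varnothing=-\infty$). If $\mathrm{CExp}^{\max}<\infty$, then $$\mathrm{CExp}^{\max}=\sup\bigl\{\mathrm{CExp}^{\mathfrak{S}} : \mathfrak{S}\text{ is a deterministic reward-based scheduler with }\Pr^{\mathfrak{S}}(\Diamond\mathit{goal})>0\bigr\}.$$ -/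

import Mathlib

open MeasureTheory ProbabilityTheory
open scoped ENNReal NNReal

/-- A Markov decision process with state space `S`, action set `Act`, rational transition
probabilities, an initial state and a reward function with values in the natural numbers.
Every state-action pair has total transition probability `0` (disabled) or `1` (enabled). -/
structure MDP (S Act : Type*) [Fintype S] where
  P : S → Act → S → ℚ≥0
  sum_P : ∀ s α, (∑ t, P s α t = 0) ∨ (∑ t, P s α t = 1)
  init : S
  rew : S → Act → ℕ

namespace MDP

variable {S Act : Type*} [Fintype S] (M : MDP S Act)

/-- `α` is enabled in `s` iff `P(s,α,·)` is not the null function. -/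
def Enabled (s : S) (α : Act) : Prop := ∃ t, M.P s α t ≠ 0

/-- The set `Act(s)` of the actions that are enabled in `s`. -/
abbrev ActAt (s : S) : Type _ := {α : Act // M.Enabled s α}

/-- A trap is a state without enabled actions. -/
def IsTrap (s : S) : Prop := ∀ α, ¬ M.Enabled s α

/-- The finite paths `s₀ α₀ s₁ α₁ … s_k` of `M` with first state `s₀` and last state `s_k`:
alternating sequences of states and actions all of whose transitions have positive probability. -/
inductive PathTo (s₀ : S) : S → Type _
  | nil : PathTo s₀ s₀
  | snoc {s : S} (π : PathTo s₀ s) (α : Act) (t : S) (h : 0 < M.P s α t) : PathTo s₀ t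

/-- The accumulated reward `rew(π)` of a finite path. -/
def PathTo.reward {M : MDP S Act} {s₀ : S} : {s : S} → M.PathTo s₀ s → ℕ
  | _, .nil => 0
  | _, .snoc (s := s) π α _ _ => π.reward + M.rew s α

/-- The finite paths of `M` with first state `s₀` (and an arbitrary last state). -/
abbrev FinPath (s₀ : S) : Type _ := Σ s : S, M.PathTo s₀ s

/-- A (randomized, history-dependent) scheduler assigns to each finite path whose last state `s` is
not a trap a probability distribution over `Act(s)`. -/
abbrev Scheduler : Type _ :=
  (s₀ s : S) → M.PathTo s₀ s → ¬ M.IsTrap s → PMF (M.ActAt s)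

/-- A scheduler is deterministic if all its distributions are Dirac distributions. -/
def IsDeterministic (𝔖 : M.Scheduler) : Prop :=
  ∀ (s₀ s : S) (π : M.PathTo s₀ s) (hs : ¬ M.IsTrap s), ∃ α, 𝔖 s₀ s π hs = PMF.pure α

/-- A scheduler is reward-based if its decisions for finite paths with the same last state and the
same accumulated reward agree. -/
def IsRewardBased (𝔖 : M.Scheduler) : Prop :=
  ∀ (s₀ s₀' s : S) (π : M.PathTo s₀ s) (π' : M.PathTo s₀' s) (hs : ¬ M.IsTrap s),
    π.reward = π'.reward → 𝔖 s₀ s π hs = 𝔖 s₀' s π' hs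

variable {M} in
theorem sum_P_eq_one {s : S} (α : M.ActAt s) :
    ∑ t, (((M.P s α t : ℚ≥0) : ℝ≥0) : ℝ≥0∞) = 1 := by
  obtain ⟨α, t, ht⟩ := α
  have h : ∑ t, M.P s α t = 1 := by
    refine (M.sum_P s α).resolve_left fun h0 => ht ?_
    exact (Finset.sum_eq_zero_iff.1 h0) t (Finset.mem_univ t)
  have h' : ∑ t, ((M.P s α t : ℚ≥0) : ℝ≥0) = 1 := by exact_mod_cast congrArg (NNRat.cast (K := ℝ≥0)) h
  exact_mod_cast congrArg (ENNReal.ofNNReal) h'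

/-- The distribution `P(s,α,·)` of the successor state after an enabled action. -/
noncomputable def trans (s : S) (α : M.ActAt s) : PMF S :=
  PMF.ofFintype (fun t => (((M.P s α t : ℚ≥0) : ℝ≥0) : ℝ≥0∞)) (sum_P_eq_one α)

variable {M} in
theorem P_pos_of_mem_support {s t : S} {α : M.ActAt s} (h : t ∈ (M.trans s α).support) :
    0 < M.P s α t := by
  rw [PMF.mem_support_iff, trans, PMF.ofFintype_apply] at h
  exact pos_iff_ne_zero.2 fun h0 => h (by simp [h0])

open Classical in
/-- One step of the process induced by a scheduler, as a random extension of the finite path that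
has been generated so far. A path that ends in a trap is maximal and stays as it is. -/
noncomputable def step (𝔖 : M.Scheduler) (s₀ : S) : M.FinPath s₀ → PMF (M.FinPath s₀)
  | ⟨s, π⟩ =>
    if hs : M.IsTrap s then PMF.pure ⟨s, π⟩
    else (𝔖 s₀ s π hs).bind fun α =>
      (M.trans s α).bindOnSupport fun t ht =>
        PMF.pure ⟨t, π.snoc α t (P_pos_of_mem_support ht)⟩

instance (s₀ : S) : MeasurableSpace (M.FinPath s₀) := ⊤

/-- Maximal paths starting in `s₀`, given by the sequence of their finite prefixes: `ω n` is the
prefix of length `n` (the whole path, if the maximal path is finite of length at most `n`).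
The product `σ`-algebra is generated by the cylinders `{ω | ω n = π}`; sequences that do not come
from a maximal path form a null set of each measure `Pr` below. -/
abbrev Run (s₀ : S) : Type _ := ℕ → M.FinPath s₀

/-- The transition kernels of the sequence of finite prefixes under a scheduler. -/
noncomputable def stepKernel (𝔖 : M.Scheduler) (s₀ : S) (n : ℕ) :
    Kernel (Π _ : Finset.Iic n, M.FinPath s₀) (M.FinPath s₀) where
  toFun h := (M.step 𝔖 s₀ (h ⟨n, Finset.mem_Iic.2 le_rfl⟩)).toMeasure
  measurable' := (measurable_from_top (f := fun π => (M.step 𝔖 s₀ π).toMeasure)).comp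
    (measurable_pi_apply _)

instance (𝔖 : M.Scheduler) (s₀ : S) (n : ℕ) : IsMarkovKernel (M.stepKernel 𝔖 s₀ n) :=
  ⟨fun h => inferInstanceAs (IsProbabilityMeasure
    (M.step 𝔖 s₀ (h ⟨n, Finset.mem_Iic.2 le_rfl⟩)).toMeasure)⟩

/-- The probability measure on maximal paths induced by a scheduler and a starting state. -/
noncomputable def Pr (𝔖 : M.Scheduler) (s₀ : S) : Measure (M.Run s₀) :=
  Kernel.traj (X := fun _ => M.FinPath s₀) (M.stepKernel 𝔖 s₀) 0 fun _ => ⟨s₀, .nil⟩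

/-- The event `◇F`: some state of `F` is reached. -/
def reach (s₀ : S) (F : Set S) : Set (M.Run s₀) := {ω | ∃ n, (ω n).1 ∈ F}

open Classical in
/-- The random variable that assigns to a maximal path the accumulated reward of its shortest
prefix with last state in `F`, and `∞` if `F` is not reached. -/
noncomputable def accReward (s₀ : S) (F : Set S) (ω : M.Run s₀) : ℝ≥0∞ :=
  if h : ∃ n, (ω n).1 ∈ F then ((ω (Nat.find h)).2.reward : ℝ≥0∞) else ⊤

/-- The conditional expectation of the accumulated reward until reaching `F`, from the initial
state and under the condition `◇G`. -/
noncomputable def cexp (F G : Set S) (𝔖 : M.Scheduler) : ℝ≥0∞ :=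
  ∫⁻ ω, M.accReward M.init F ω ∂(ProbabilityTheory.cond (M.Pr 𝔖 M.init) (M.reach M.init G))

/-- The maximal conditional expectation: the supremum of `cexp` over all schedulers under which
`◇G` has positive probability and `◇F` has conditional probability one given `◇G`. -/
noncomputable def cexpMax (F G : Set S) : EReal :=
  sSup {x | ∃ 𝔖 : M.Scheduler, 0 < M.Pr 𝔖 M.init (M.reach M.init G) ∧
    ProbabilityTheory.cond (M.Pr 𝔖 M.init) (M.reach M.init G) (M.reach M.init F) = 1 ∧
    x = (M.cexp F G 𝔖 : EReal)}

/-- `(E, 𝔄)` is an end component: `E` is a nonempty set of states, `𝔄` assigns to each state of `E`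
a nonempty set of enabled actions, no chosen action leaves `E`, and the induced graph is strongly
connected. -/
structure IsEndComponent (E : Set S) (𝔄 : S → Set Act) : Prop where
  nonempty : E.Nonempty
  act_nonempty : ∀ s ∈ E, (𝔄 s).Nonempty
  act_enabled : ∀ s ∈ E, ∀ α ∈ 𝔄 s, M.Enabled s α
  closed : ∀ s ∈ E, ∀ α ∈ 𝔄 s, ∀ t, 0 < M.P s α t → t ∈ E
  connected : ∀ s ∈ E, ∀ t ∈ E,
    Relation.ReflTransGen (fun u v => u ∈ E ∧ ∃ α ∈ 𝔄 u, 0 < M.P u α v) s t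

end MDP

/-! The conditional expectation is the quotient of the expected reward on `◇goal` by the probability
of `◇goal`. It exceeds `θ` iff the unconditional expectation of `shiftedPayoff goal θ` does: pay the
accumulated reward at `goal` and `θ` in every other trap (`coe_lt_cexp_iff`,
`coe_lt_payoff_shiftedPayoff_iff`). This payoff depends only on the trap and the accumulated reward,
so dynamic programming on `S × ℕ` yields an optimal scheduler that is deterministic and reward-based
(`exists_optimal_scheduler`). Hence whatever threshold some scheduler exceeds is also exceeded by a
scheduler of the simple kind.

Greedy choices are optimal only if no value is lost along runs that never stop. Without end
components there is a weight `W s r`, linear in `r`, whose expectation over runs not yet trapped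
decays geometrically (`exists_geometric_supermartingale`). It dominates the value function, so the
value is collected in traps. -/

theorem PMF.lintegral_toMeasure_eq_tsum {α : Type*} [MeasurableSpace α] (p : PMF α)
    {g : α → ℝ≥0∞} (hg : Measurable g) : ∫⁻ x, g x ∂p.toMeasure = ∑' x, p x * g x := by
  have h : p.toMeasure = Measure.sum fun a => p a • Measure.dirac a := by
    ext s hs
    rw [PMF.toMeasure_apply _ hs, Measure.sum_apply _ hs]
    refine tsum_congr fun a => ?_
    by_cases ha : a ∈ s <;> simp [hs, ha]
  rw [h, lintegral_sum_measure]
  refine tsum_congr fun a => ?_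
  rw [lintegral_smul_measure, lintegral_dirac' _ hg, smul_eq_mul]

/-! ### One-step integrals and the Markov property. -/

namespace MDP

variable {S Act : Type*} [Fintype S] (M : MDP S Act)

/-- The value of a function of state and accumulated reward at a finite path. -/
def onPath {β : Type*} (F : S → ℕ → β) {s₀ : S} (π : M.FinPath s₀) : β := F π.1 π.2.reward

/-- The expected value of `F` after choosing `α` in `s` with accumulated reward `r`. -/
noncomputable def qValue (F : S → ℕ → ℝ≥0∞) (s : S) (r : ℕ) (α : M.ActAt s) : ℝ≥0∞ :=
  ∑ t, M.trans s α t * F t (r + M.rew s α)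

theorem qValue_mono {F G : S → ℕ → ℝ≥0∞} (h : F ≤ G) (s : S) (r : ℕ) (α : M.ActAt s) :
    M.qValue F s r α ≤ M.qValue G s r α :=
  Finset.sum_le_sum fun _ _ => mul_le_mul_right (h _ _) _

variable (𝔖 : M.Scheduler) (s₀ : S)

theorem lintegral_step_of_trap (g : M.FinPath s₀ → ℝ≥0∞) (π : M.FinPath s₀)
    (hs : M.IsTrap π.1) : ∫⁻ x, g x ∂(M.step 𝔖 s₀ π).toMeasure = g π := by
  obtain ⟨s, π⟩ := π
  have : M.step 𝔖 s₀ ⟨s, π⟩ = PMF.pure ⟨s, π⟩ := by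
    simp only [step]; exact dif_pos hs
  rw [this, PMF.toMeasure_pure, lintegral_dirac]

/-- `onPath F` sees only the last state and the reward, so the integral over extended paths
collapses to an average of `qValue`. -/
theorem lintegral_step_of_not_trap (F : S → ℕ → ℝ≥0∞) (π : M.FinPath s₀)
    (hs : ¬ M.IsTrap π.1) :
    ∫⁻ x, M.onPath F x ∂(M.step 𝔖 s₀ π).toMeasure =
      ∑' α, 𝔖 s₀ π.1 π.2 hs α * M.qValue F π.1 π.2.reward α := by
  obtain ⟨s, π⟩ := π
  have : M.step 𝔖 s₀ ⟨s, π⟩ = (𝔖 s₀ s π hs).bind fun α =>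
      (M.trans s α).bindOnSupport fun t ht =>
        PMF.pure ⟨t, π.snoc α t (P_pos_of_mem_support ht)⟩ := by
    simp only [step]; exact dif_neg hs
  rw [this, PMF.lintegral_toMeasure_eq_tsum _ measurable_from_top]
  simp only [PMF.bind_apply, ← ENNReal.tsum_mul_right]
  rw [ENNReal.tsum_comm]
  refine tsum_congr fun α => ?_
  simp only [mul_assoc, ENNReal.tsum_mul_left]
  congr 1
  simp only [PMF.bindOnSupport_apply, ← ENNReal.tsum_mul_right]
  rw [ENNReal.tsum_comm, tsum_fintype, qValue]
  refine Finset.sum_congr rfl fun t _ => ?_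
  simp only [mul_assoc, ENNReal.tsum_mul_left]
  by_cases h : M.trans s α t = 0
  · simp [h]
  · congr 1
    simp only [h, dif_neg, not_false_eq_true]
    rw [tsum_eq_single ⟨t, π.snoc α t (P_pos_of_mem_support h)⟩]
    · simp [onPath, PathTo.reward]
    · intro b hb
      rw [PMF.pure_apply_of_ne _ _ hb, zero_mul]

instance : IsProbabilityMeasure (M.Pr 𝔖 s₀) := by
  unfold Pr; infer_instance

/-- The Markov property: the law of the prefixes up to `n` together with the next one is a
composition product with `stepKernel`, which reads only coordinate `n`. -/
theorem lintegral_pair (n : ℕ) (f : M.FinPath s₀ × M.FinPath s₀ → ℝ≥0∞) (hf : Measurable f) :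
    ∫⁻ ω, f (ω n, ω (n + 1)) ∂M.Pr 𝔖 s₀ =
      ∫⁻ ω, ∫⁻ y, f (ω n, y) ∂(M.step 𝔖 s₀ (ω n)).toMeasure ∂M.Pr 𝔖 s₀ := by
  set x₀ : Π _ : Finset.Iic 0, M.FinPath s₀ := fun _ => ⟨s₀, .nil⟩
  have h := Kernel.partialTraj_compProd_eq_map_traj (X := fun _ => M.FinPath s₀)
    (κ := M.stepKernel 𝔖 s₀) (Nat.zero_le n) (x₀ := x₀)
  set g : (Π _ : Finset.Iic n, M.FinPath s₀) × M.FinPath s₀ → ℝ≥0∞ :=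
    fun p => f (p.1 ⟨n, Finset.mem_Iic.2 le_rfl⟩, p.2)
  have hg : Measurable g := hf.comp (by fun_prop)
  have h1 : ∫⁻ ω, f (ω n, ω (n + 1)) ∂M.Pr 𝔖 s₀ =
      ∫⁻ p, g p ∂((Kernel.traj (X := fun _ => M.FinPath s₀) (M.stepKernel 𝔖 s₀) 0 x₀).map
        fun x => (Preorder.frestrictLe n x, x (n + 1))) := by
    rw [lintegral_map hg (by fun_prop)]; rfl
  rw [h1, ← h, Measure.lintegral_compProd hg]
  have h2 := Kernel.traj_map_frestrictLe_apply (X := fun _ => M.FinPath s₀) (κ := M.stepKernel 𝔖 s₀) 0 n x₀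
  rw [← h2, lintegral_map _ (by fun_prop)]
  · rfl
  · exact hg.lintegral_kernel_prod_right'

theorem lintegral_succ (n : ℕ) (g : M.FinPath s₀ → ℝ≥0∞) :
    ∫⁻ ω, g (ω (n + 1)) ∂M.Pr 𝔖 s₀ =
      ∫⁻ ω, ∫⁻ y, g y ∂(M.step 𝔖 s₀ (ω n)).toMeasure ∂M.Pr 𝔖 s₀ :=
  M.lintegral_pair 𝔖 s₀ n (fun p => g p.2) (measurable_from_top.comp measurable_snd)

theorem lintegral_zero_coord (g : M.FinPath s₀ → ℝ≥0∞) :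
    ∫⁻ ω, g (ω 0) ∂M.Pr 𝔖 s₀ = g ⟨s₀, .nil⟩ := by
  set x₀ : Π _ : Finset.Iic 0, M.FinPath s₀ := fun _ => ⟨s₀, .nil⟩
  have h2 := Kernel.traj_map_frestrictLe_apply (X := fun _ => M.FinPath s₀) (κ := M.stepKernel 𝔖 s₀) 0 0 x₀
  rw [Kernel.partialTraj_self, Kernel.id_apply] at h2
  have hg : Measurable fun p : Π _ : Finset.Iic 0, M.FinPath s₀ =>
      g (p ⟨0, Finset.mem_Iic.2 le_rfl⟩) := measurable_from_top.comp (measurable_pi_apply _)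
  have h3 := congrArg (fun μ => ∫⁻ p, g (p ⟨0, Finset.mem_Iic.2 le_rfl⟩) ∂μ) h2
  rw [lintegral_map hg (by fun_prop), lintegral_dirac' _ hg] at h3
  exact h3

theorem ae_trap_stays : ∀ᵐ ω ∂M.Pr 𝔖 s₀, ∀ n, M.IsTrap (ω n).1 →
    (ω (n + 1)).1 = (ω n).1 ∧ (ω (n + 1)).2.reward = (ω n).2.reward := by
  classical
  rw [ae_all_iff]
  intro n
  -- Paths are compared only through state and reward: these range over a countable type, so
  -- measurability of `A` is free even if there are uncountably many paths.
  let A : Set ((S × ℕ) × (S × ℕ)) := {p | ¬ (M.IsTrap p.1.1 → p.2 = p.1)}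
  let key : M.FinPath s₀ → S × ℕ := fun π => (π.1, π.2.reward)
  let _ : MeasurableSpace S := ⊤
  have hkey : Measurable key := measurable_from_top
  have hA : MeasurableSet A := A.to_countable.measurableSet
  let f : M.FinPath s₀ × M.FinPath s₀ → ℝ≥0∞ := fun p => A.indicator 1 (key p.1, key p.2)
  have hf : Measurable f := (measurable_one.indicator hA).comp (by fun_prop)
  have h := M.lintegral_pair 𝔖 s₀ n f hf
  have h0 : ∀ x : M.FinPath s₀, ∫⁻ y, f (x, y) ∂(M.step 𝔖 s₀ x).toMeasure = 0 := by
    intro x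
    by_cases hx : M.IsTrap x.1
    · rw [M.lintegral_step_of_trap 𝔖 s₀ (fun y => f (x, y)) x hx]
      simp [f, A]
    · simp [f, A, key, hx]
  simp only [h0, lintegral_zero] at h
  have hm : Measurable fun ω : M.Run s₀ => f (ω n, ω (n + 1)) := hf.comp (by fun_prop)
  rw [lintegral_eq_zero_iff hm] at h
  filter_upwards [h] with ω hω htrap
  by_contra hne
  have : (key (ω n), key (ω (n + 1))) ∈ A := by
    simp only [A, Set.mem_ofPred_eq, key, Prod.mk.injEq, Classical.not_imp]
    exact ⟨htrap, hne⟩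
  simp [f, this] at hω

end MDP

/-! ### Supermartingales from the absence of end components. -/

namespace MDP

variable {S Act : Type*} [Fintype S] (M : MDP S Act)

/-- A nonempty set of states that can be kept invariant by a choice of actions contains an end
component. -/
theorem exists_isEndComponent_of_closed {E : Set S} (hne : E.Nonempty)
    (hE : ∀ s ∈ E, ∃ α, M.Enabled s α ∧ ∀ t, 0 < M.P s α t → t ∈ E) :
    ∃ (E : Set S) (𝔄 : S → Set Act), M.IsEndComponent E 𝔄 := by
  let C : Set (Set S) := {E | E.Nonempty ∧
    ∀ s ∈ E, ∃ α, M.Enabled s α ∧ ∀ t, 0 < M.P s α t → t ∈ E}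
  -- In a minimal such set, the part reachable from any of its states can again be kept invariant,
  -- hence is everything: this is strong connectivity.
  obtain ⟨E, hEC, hmin⟩ := (Set.toFinite C).exists_minimal ⟨E, hne, hE⟩
  let 𝔄 : S → Set Act := fun s => {α | M.Enabled s α ∧ ∀ t, 0 < M.P s α t → t ∈ E}
  refine ⟨E, 𝔄, hEC.1, hEC.2, fun s _ α h => h.1, fun s _ α h => h.2, fun s hs => ?_⟩
  let R : Set S := {t | t ∈ E ∧
    Relation.ReflTransGen (fun u v => u ∈ E ∧ ∃ α ∈ 𝔄 u, 0 < M.P u α v) s t}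
  have hR : R ∈ C := by
    refine ⟨⟨s, hs, .refl⟩, fun u hu => ?_⟩
    obtain ⟨α, hα, h⟩ := hEC.2 u hu.1
    exact ⟨α, hα, fun t ht => ⟨h t ht, hu.2.tail ⟨hu.1, α, ⟨hα, h⟩, ht⟩⟩⟩
  exact fun t ht => (hmin hR (fun u hu => hu.1) ht).2

theorem sum_P_real_eq_one {s : S} {α : Act} (h : M.Enabled s α) :
    ∑ t, (M.P s α t : ℝ) = 1 := by
  have h' := sum_P_eq_one (M := M) ⟨α, h⟩
  have h2 : ∑ t, ((M.P s α t : ℚ≥0) : ℝ≥0) = 1 := by exact_mod_cast h'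
  have := congrArg (NNReal.toReal) h2
  push_cast at this
  exact this

open Filter Topology in
/-- Without end components there is a bounded function of the state that strictly decreases in
expectation with each transition. -/
theorem exists_strict_supermartingale [Finite Act]
    (hEC : ¬ ∃ (E : Set S) (𝔄 : S → Set Act), M.IsEndComponent E 𝔄) :
    ∃ w : S → ℝ, (∀ s, 1 ≤ w s) ∧
      ∀ s α, M.Enabled s α → ∑ t, (M.P s α t : ℝ) * w t < w s := by
  classical
  -- `U` is the region where `w` already descends, with `w = 2` outside. If a maximal `U` were
  -- proper, some `s ∉ U` would have only actions that enter `U` with positive probability, for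
  -- otherwise `Uᶜ` would contain an end component. Lowering `w s` to just below `2` then adds `s`
  -- to `U`; elsewhere it can only decrease the averages.
  let C : Set (Set S) := {U | ∃ w : S → ℝ, (∀ s, 1 ≤ w s) ∧ (∀ s, w s ≤ 2) ∧ (∀ s ∈ U, w s < 2) ∧
    (∀ s ∉ U, w s = 2) ∧ ∀ s ∈ U, ∀ α, M.Enabled s α → ∑ t, (M.P s α t : ℝ) * w t < w s}
  have h0 : ∅ ∈ C := ⟨fun _ => 2, by simp, by simp, by simp, by simp, by simp⟩
  obtain ⟨U, ⟨w, h1, h2, h3, h4, h5⟩, hmax⟩ := (Set.toFinite C).exists_maximal ⟨∅, h0⟩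
  suffices hU : U = Set.univ from ⟨w, h1, fun s => h5 s (hU ▸ Set.mem_univ s)⟩
  by_contra hU
  have hne : (Uᶜ).Nonempty := Set.nonempty_compl.2 hU
  obtain ⟨s, hsU, hs⟩ : ∃ s ∉ U, ∀ α, M.Enabled s α → ∃ t, 0 < M.P s α t ∧ t ∈ U := by
    by_contra! hcon
    exact hEC (M.exists_isEndComponent_of_closed hne hcon)
  have hlt : ∀ α, M.Enabled s α → ∑ t, (M.P s α t : ℝ) * w t < 2 := by
    intro α hα
    obtain ⟨t, ht, htU⟩ := hs α hα
    calc ∑ t, (M.P s α t : ℝ) * w t < ∑ t, (M.P s α t : ℝ) * 2 := by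
          refine Finset.sum_lt_sum (fun u _ => by gcongr; exact h2 u) ⟨t, Finset.mem_univ t, ?_⟩
          have : (0 : ℝ) < M.P s α t := by exact_mod_cast ht
          gcongr
          exact h3 t htU
      _ = 2 := by rw [← Finset.sum_mul, M.sum_P_real_eq_one hα, one_mul]
  have hev : ∀ᶠ m in 𝓝[<] (2 : ℝ),
      (∀ α, M.Enabled s α → ∑ t, (M.P s α t : ℝ) * w t < m) ∧ 1 < m ∧ m < 2 := by
    refine (eventually_all.2 fun α => ?_).and
      (((eventually_gt_nhds (by norm_num)).filter_mono nhdsWithin_le_nhds).and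
        eventually_mem_nhdsWithin)
    by_cases hα : M.Enabled s α
    · exact ((eventually_gt_nhds (hlt α hα)).filter_mono nhdsWithin_le_nhds).mono fun _ h _ => h
    · exact Eventually.of_forall fun _ h => absurd h hα
  obtain ⟨m, hm, hm1, hm2⟩ := hev.exists
  have hle : ∀ t, Function.update w s m t ≤ w t := by
    intro t
    rcases eq_or_ne t s with rfl | h
    · rw [Function.update_self, h4 t hsU]; exact hm2.le
    · rw [Function.update_of_ne h]
  have hsum : ∀ u α, ∑ t, (M.P u α t : ℝ) * Function.update w s m t ≤
      ∑ t, (M.P u α t : ℝ) * w t := fun u α =>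
    Finset.sum_le_sum fun t _ => by gcongr; exact hle t
  have hmem : insert s U ∈ C := by
    refine ⟨Function.update w s m, fun t => ?_, fun t => (hle t).trans (h2 t), fun t ht => ?_,
      fun t ht => ?_, fun t ht α hα => (hsum t α).trans_lt ?_⟩
    · rcases eq_or_ne t s with rfl | h
      · rw [Function.update_self]; exact hm1.le
      · rw [Function.update_of_ne h]; exact h1 t
    · rcases eq_or_ne t s with rfl | h
      · rw [Function.update_self]; exact hm2
      · rw [Function.update_of_ne h]; exact h3 t (ht.resolve_left h)
    · rw [Set.mem_insert_iff, not_or] at ht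
      rw [Function.update_of_ne ht.1]; exact h4 t ht.2
    · rcases eq_or_ne t s with rfl | h
      · rw [Function.update_self]; exact hm α hα
      · rw [Function.update_of_ne h]; exact h5 t (ht.resolve_left h) α hα
  exact hsU (hmax hmem (Set.subset_insert s U) (Set.mem_insert s U))

open Filter Topology in
/-- Without end components there is a function of the state and the accumulated reward that
grows linearly in the latter and decreases geometrically in expectation. -/
theorem exists_geometric_supermartingale [Finite Act]
    (hEC : ¬ ∃ (E : Set S) (𝔄 : S → Set Act), M.IsEndComponent E 𝔄) (c : ℝ≥0) :
    ∃ (l : ℝ≥0) (W : S → ℕ → ℝ≥0), l < 1 ∧ (∀ s r, r + c ≤ W s r) ∧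
      ∀ s r (α : M.ActAt s),
        M.qValue (fun s r => (W s r : ℝ≥0∞)) s r α ≤ l * W s r := by
  obtain ⟨w, hw1, hw⟩ := M.exists_strict_supermartingale hEC
  -- There are finitely many strict inequalities, so one factor `l < 1` serves all of them.
  have hev : ∀ᶠ l in 𝓝[<] (1 : ℝ),
      (∀ s α, M.Enabled s α → ∑ t, (M.P s α t : ℝ) * w t < l * w s) ∧ 0 < l ∧ l < 1 := by
    refine (eventually_all.2 fun s => eventually_all.2 fun α => ?_).and
      (((eventually_gt_nhds (by norm_num)).filter_mono nhdsWithin_le_nhds).and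
        eventually_mem_nhdsWithin)
    by_cases hα : M.Enabled s α
    · have ht : Tendsto (fun l : ℝ => l * w s) (𝓝 1) (𝓝 (w s)) := by
        simpa using (continuous_mul_const (w s)).tendsto 1
      exact ((ht.eventually (eventually_gt_nhds (hw s α hα))).filter_mono nhdsWithin_le_nhds).mono
        fun _ h _ => h
    · exact Eventually.of_forall fun _ h => absurd h hα
  obtain ⟨l, hl, hl0, hl1⟩ := hev.exists
  obtain ⟨R, hR⟩ : ∃ R : ℝ, ∀ s α, (M.rew s α : ℝ) ≤ R := by
    obtain ⟨R, hR⟩ := (Set.finite_range fun p : S × Act => (M.rew p.1 p.2 : ℝ)).bddAbove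
    exact ⟨R, fun s α => hR ⟨(s, α), rfl⟩⟩
  -- The weight is `(r + k) * w s`. A step multiplies `w` by at most `l` in expectation and adds at
  -- most `R` to `r`; `k` is so large that `(r + R + k) * l ≤ l' * (r + k)`.
  set l' : ℝ := (1 + l) / 2 with hl'
  set k : ℝ := max c (R * l / (l' - l)) with hk
  have hll : 0 < l' - l := by linarith
  have hkc : (c : ℝ) ≤ k := le_max_left _ _
  have hk0 : 0 ≤ k := c.2.trans hkc
  have hkR : R * l ≤ (l' - l) * k := by
    have : R * l / (l' - l) ≤ k := le_max_right _ _
    rw [div_le_iff₀ hll] at this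
    linarith
  have hw0 : ∀ s, 0 ≤ w s := fun s => zero_le_one.trans (hw1 s)
  obtain ⟨a, ha⟩ : ∃ a : ℝ≥0, (a : ℝ) = l' := NNReal.canLift.prf l' (by linarith)
  obtain ⟨b, hb⟩ : ∃ b : ℝ≥0, (b : ℝ) = k := NNReal.canLift.prf k hk0
  choose v hv using fun s => (NNReal.canLift.prf (w s) (hw0 s) : ∃ x : ℝ≥0, (x : ℝ) = w s)
  refine ⟨a, fun s r => (r + b) * v s, ?_, ?_, ?_⟩
  · rw [← NNReal.coe_lt_coe, ha, NNReal.coe_one]; linarith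
  · intro s r
    rw [← NNReal.coe_le_coe]
    push_cast
    rw [hv, hb]
    nlinarith [hw1 s, hkc, hk0, (Nat.cast_nonneg r : (0 : ℝ) ≤ r)]
  · rintro s r ⟨α, hα⟩
    simp only [qValue]
    change ∑ t, (((M.P s α t : ℚ≥0) : ℝ≥0) : ℝ≥0∞) * _ ≤ _
    norm_cast
    rw [← NNReal.coe_le_coe]
    push_cast
    simp only [ha, hb, hv]
    change ∑ t, (M.P s α t : ℝ) * ((r + M.rew s α + k) * w t) ≤ l' * ((r + k) * w s)
    have h1 : ∑ t, (M.P s α t : ℝ) * ((r + M.rew s α + k) * w t) =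
        (r + M.rew s α + k) * ∑ t, (M.P s α t : ℝ) * w t := by
      rw [Finset.mul_sum]
      refine Finset.sum_congr rfl fun t _ => ?_
      ring
    rw [h1]
    calc (r + M.rew s α + k) * ∑ t, (M.P s α t : ℝ) * w t
        ≤ (r + M.rew s α + k) * (l * w s) := by
          gcongr
          exact (hl s α hα).le
      _ = ((r + M.rew s α + k) * l) * w s := by ring
      _ ≤ (l' * (r + k)) * w s := by
          refine mul_le_mul_of_nonneg_right ?_ (hw0 s)
          have := mul_le_mul_of_nonneg_right (hR s α) hl0.le
          have h3 : l * r ≤ l' * r := by gcongr; linarith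
          nlinarith
      _ = l' * ((r + k) * w s) := by ring

end MDP

/-! ### Expected payoffs in traps. -/

namespace MDP

variable {S Act : Type*} [Fintype S] (M : MDP S Act)

open Classical in
/-- `F` on traps and `0` elsewhere. -/
noncomputable def trapPart (F : S → ℕ → ℝ≥0∞) (s : S) (r : ℕ) : ℝ≥0∞ :=
  if M.IsTrap s then F s r else 0

open Classical in
/-- `0` on traps and `F` elsewhere. -/
noncomputable def freePart (F : S → ℕ → ℝ≥0∞) (s : S) (r : ℕ) : ℝ≥0∞ :=
  if M.IsTrap s then 0 else F s r

theorem trapPart_add_freePart (F : S → ℕ → ℝ≥0∞) : M.trapPart F + M.freePart F = F := by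
  funext s r
  by_cases h : M.IsTrap s <;> simp [trapPart, freePart, h]

/-- The expected value of `F` at the `n`-th prefix. -/
noncomputable def expAt (𝔖 : M.Scheduler) (s₀ : S) (F : S → ℕ → ℝ≥0∞) (n : ℕ) : ℝ≥0∞ :=
  ∫⁻ ω, M.onPath F (ω n) ∂M.Pr 𝔖 s₀

/-- The expected payoff `φ` obtained in the trap that is eventually reached. -/
noncomputable def payoff (𝔖 : M.Scheduler) (s₀ : S) (φ : S → ℕ → ℝ≥0∞) : ℝ≥0∞ :=
  ⨆ n, M.expAt 𝔖 s₀ (M.trapPart φ) n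

variable (𝔖 : M.Scheduler) (s₀ : S)

theorem measurable_onPath (F : S → ℕ → ℝ≥0∞) (n : ℕ) :
    Measurable fun ω : M.Run s₀ => M.onPath F (ω n) :=
  (measurable_from_top (f := fun π : M.FinPath s₀ => M.onPath F π)).comp (measurable_pi_apply n)

theorem expAt_zero (F : S → ℕ → ℝ≥0∞) : M.expAt 𝔖 s₀ F 0 = F s₀ 0 :=
  M.lintegral_zero_coord 𝔖 s₀ (M.onPath F)

theorem expAt_succ (F : S → ℕ → ℝ≥0∞) (n : ℕ) : M.expAt 𝔖 s₀ F (n + 1) =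
    ∫⁻ ω, ∫⁻ y, M.onPath F y ∂(M.step 𝔖 s₀ (ω n)).toMeasure ∂M.Pr 𝔖 s₀ :=
  M.lintegral_succ 𝔖 s₀ n (M.onPath F)

theorem expAt_mono {F G : S → ℕ → ℝ≥0∞} (h : F ≤ G) (n : ℕ) :
    M.expAt 𝔖 s₀ F n ≤ M.expAt 𝔖 s₀ G n :=
  lintegral_mono fun _ => h _ _

theorem expAt_add (F G : S → ℕ → ℝ≥0∞) (n : ℕ) :
    M.expAt 𝔖 s₀ (F + G) n = M.expAt 𝔖 s₀ F n + M.expAt 𝔖 s₀ G n :=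
  lintegral_add_left (M.measurable_onPath s₀ F n) _

theorem expAt_const_mul (c : ℝ≥0∞) (F : S → ℕ → ℝ≥0∞) (n : ℕ) :
    M.expAt 𝔖 s₀ (fun s r => c * F s r) n = c * M.expAt 𝔖 s₀ F n :=
  lintegral_const_mul c (M.measurable_onPath s₀ F n)

/-- A trapped run keeps its payoff and any other run has contributed `0` so far. Thus the supremum
in `payoff` is a limit, which makes it additive. -/
theorem monotone_expAt_trapPart (φ : S → ℕ → ℝ≥0∞) :
    Monotone (M.expAt 𝔖 s₀ (M.trapPart φ)) := by
  refine monotone_nat_of_le_succ fun n => ?_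
  rw [expAt_succ]
  refine lintegral_mono fun ω => ?_
  by_cases h : M.IsTrap (ω n).1
  · rw [M.lintegral_step_of_trap 𝔖 s₀ _ _ h]
  · simp [onPath, trapPart, h]

theorem payoff_add (φ ψ : S → ℕ → ℝ≥0∞) :
    M.payoff 𝔖 s₀ (φ + ψ) = M.payoff 𝔖 s₀ φ + M.payoff 𝔖 s₀ ψ := by
  rw [payoff, payoff, payoff, ENNReal.iSup_add_iSup_of_monotone
    (M.monotone_expAt_trapPart 𝔖 s₀ φ) (M.monotone_expAt_trapPart 𝔖 s₀ ψ)]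
  refine iSup_congr fun n => ?_
  rw [← expAt_add]
  congr 1
  funext s r
  by_cases h : M.IsTrap s <;> simp [trapPart, h]

theorem payoff_const_mul (c : ℝ≥0∞) (φ : S → ℕ → ℝ≥0∞) :
    M.payoff 𝔖 s₀ (fun s r => c * φ s r) = c * M.payoff 𝔖 s₀ φ := by
  rw [payoff, payoff, ENNReal.mul_iSup]
  refine iSup_congr fun n => ?_
  rw [← expAt_const_mul]
  congr 1
  funext s r
  by_cases h : M.IsTrap s <;> simp [trapPart, h]

theorem expAt_freePart_le {l : ℝ≥0∞} {W : S → ℕ → ℝ≥0∞}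
    (hW : ∀ s r (α : M.ActAt s), M.qValue W s r α ≤ l * W s r) (n : ℕ) :
    M.expAt 𝔖 s₀ (M.freePart W) n ≤ l ^ n * W s₀ 0 := by
  have hle : M.freePart W ≤ W := fun s r => by
    by_cases h : M.IsTrap s <;> simp [freePart, h]
  induction n with
  | zero => rw [expAt_zero, pow_zero, one_mul]; exact hle _ _
  | succ n ih =>
    calc M.expAt 𝔖 s₀ (M.freePart W) (n + 1)
        ≤ M.expAt 𝔖 s₀ (fun s r => l * M.freePart W s r) n := by
          rw [expAt_succ]
          refine lintegral_mono fun ω => ?_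
          by_cases h : M.IsTrap (ω n).1
          · rw [M.lintegral_step_of_trap 𝔖 s₀ _ _ h]
            simp [onPath, freePart, h]
          · rw [M.lintegral_step_of_not_trap 𝔖 s₀ _ _ h]
            calc _ ≤ ∑' α, 𝔖 s₀ (ω n).1 (ω n).2 h α * (l * W (ω n).1 (ω n).2.reward) := by
                  refine ENNReal.tsum_le_tsum fun α => ?_
                  gcongr
                  exact (M.qValue_mono hle _ _ _).trans (hW _ _ _)
              _ = _ := by
                  rw [ENNReal.tsum_mul_right, PMF.tsum_coe, one_mul]
                  simp [onPath, freePart, h]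
      _ = l * M.expAt 𝔖 s₀ (M.freePart W) n := M.expAt_const_mul 𝔖 s₀ l _ n
      _ ≤ l * (l ^ n * W s₀ 0) := by gcongr
      _ = l ^ (n + 1) * W s₀ 0 := by rw [pow_succ']; ring

open Filter Topology in
-- No mass escapes: the contribution of the runs not yet trapped is at most `l ^ n * W s₀ 0`, which
-- vanishes in the limit.
theorem le_payoff_of_forall_le_expAt {l : ℝ≥0} (hl : l < 1) {W : S → ℕ → ℝ≥0}
    (hW : ∀ s r (α : M.ActAt s), M.qValue (fun s r => (W s r : ℝ≥0∞)) s r α ≤ l * W s r)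
    {F : S → ℕ → ℝ≥0∞} (hF : ∀ s r, F s r ≤ W s r) {c : ℝ≥0∞}
    (h : ∀ n, c ≤ M.expAt 𝔖 s₀ F n) : c ≤ M.payoff 𝔖 s₀ F := by
  have hn : ∀ n, c ≤ M.payoff 𝔖 s₀ F + (l : ℝ≥0∞) ^ n * W s₀ 0 := by
    intro n
    refine (h n).trans ?_
    rw [← M.trapPart_add_freePart F, expAt_add, M.trapPart_add_freePart F]
    refine add_le_add (le_iSup (M.expAt 𝔖 s₀ (M.trapPart F)) n)
      (le_trans (M.expAt_mono 𝔖 s₀ ?_ n) (M.expAt_freePart_le 𝔖 s₀ hW n))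
    intro s r
    by_cases h : M.IsTrap s <;> simp [freePart, h, hF]
  have ht : Tendsto (fun n => M.payoff 𝔖 s₀ F + (l : ℝ≥0∞) ^ n * W s₀ 0) atTop
      (𝓝 (M.payoff 𝔖 s₀ F + 0 * W s₀ 0)) :=
    tendsto_const_nhds.add (ENNReal.Tendsto.mul_const
      (ENNReal.tendsto_pow_atTop_nhds_zero_of_lt_one (by exact_mod_cast hl))
      (Or.inr ENNReal.coe_ne_top))
  rw [zero_mul, add_zero] at ht
  exact ge_of_tendsto' ht hn

/-- Equivalently, a trap is reached almost surely. -/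
theorem payoff_one [Finite Act]
    (hEC : ¬ ∃ (E : Set S) (𝔄 : S → Set Act), M.IsEndComponent E 𝔄) :
    M.payoff 𝔖 s₀ (fun _ _ => 1) = 1 := by
  refine le_antisymm (iSup_le fun n => ?_) ?_
  · refine (M.expAt_mono 𝔖 s₀ (G := fun _ _ => 1) (fun s r => ?_) n).trans ?_
    · by_cases h : M.IsTrap s <;> simp [trapPart, h]
    · simp [expAt, onPath]
  · obtain ⟨l, W, hl, hc, hW⟩ := M.exists_geometric_supermartingale hEC 1
    refine M.le_payoff_of_forall_le_expAt 𝔖 s₀ hl hW (fun s r => ?_) fun n => ?_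
    · exact_mod_cast le_trans (le_add_of_nonneg_left zero_le) (hc s r)
    · simp [expAt, onPath]

/-! ### Dynamic programming on states and accumulated rewards. -/

open Classical in
/-- The Bellman operator of the problem to maximize the expected payoff `φ`. -/
noncomputable def bellman (φ : S → ℕ → ℝ≥0∞) : (S → ℕ → ℝ≥0∞) →o (S → ℕ → ℝ≥0∞) where
  toFun F s r := if M.IsTrap s then φ s r else ⨆ α : M.ActAt s, M.qValue F s r α
  monotone' F G h s r := by
    by_cases hs : M.IsTrap s
    · simp [hs]
    · simp only [hs, if_false]
      exact iSup_mono fun α => M.qValue_mono h s r α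

theorem bellman_of_trap (φ F : S → ℕ → ℝ≥0∞) {s : S} (hs : M.IsTrap s) (r : ℕ) :
    M.bellman φ F s r = φ s r :=
  if_pos hs

theorem bellman_of_not_trap (φ F : S → ℕ → ℝ≥0∞) {s : S} (hs : ¬ M.IsTrap s) (r : ℕ) :
    M.bellman φ F s r = ⨆ α : M.ActAt s, M.qValue F s r α :=
  if_neg hs

/-- The optimal value of the payoff `φ`. -/
noncomputable def value (φ : S → ℕ → ℝ≥0∞) : S → ℕ → ℝ≥0∞ := (M.bellman φ).lfp

theorem value_of_trap (φ : S → ℕ → ℝ≥0∞) {s : S} (hs : M.IsTrap s) (r : ℕ) :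
    M.value φ s r = φ s r := by
  rw [value, ← OrderHom.map_lfp]
  exact M.bellman_of_trap φ _ hs r

theorem value_of_not_trap (φ : S → ℕ → ℝ≥0∞) {s : S} (hs : ¬ M.IsTrap s) (r : ℕ) :
    M.value φ s r = ⨆ α : M.ActAt s, M.qValue (M.value φ) s r α := by
  conv_lhs => rw [value, ← OrderHom.map_lfp]
  exact M.bellman_of_not_trap φ _ hs r

/-- A randomized choice averages `qValue` and so stays below its supremum; hence the expectation of
`value` does not increase along the run. -/
theorem payoff_le_value (φ : S → ℕ → ℝ≥0∞) : M.payoff 𝔖 s₀ φ ≤ M.value φ s₀ 0 := by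
  refine iSup_le fun n => (M.expAt_mono 𝔖 s₀ (G := M.value φ) (fun s r => ?_) n).trans ?_
  · by_cases h : M.IsTrap s
    · simp [trapPart, h, M.value_of_trap φ h]
    · simp [trapPart, h]
  · induction n with
    | zero => rw [expAt_zero]
    | succ n ih =>
      refine le_trans ?_ ih
      rw [expAt_succ]
      refine lintegral_mono fun ω => ?_
      by_cases h : M.IsTrap (ω n).1
      · rw [M.lintegral_step_of_trap 𝔖 s₀ _ _ h]
      · rw [M.lintegral_step_of_not_trap 𝔖 s₀ _ _ h, onPath, M.value_of_not_trap φ h]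
        calc _ ≤ ∑' α, 𝔖 s₀ (ω n).1 (ω n).2 h α *
              ⨆ α, M.qValue (M.value φ) (ω n).1 (ω n).2.reward α :=
              ENNReal.tsum_le_tsum fun α => by gcongr; exact le_iSup (M.qValue _ _ _) α
          _ = _ := by rw [ENNReal.tsum_mul_right, PMF.tsum_coe, one_mul]

/-- Without end components, some deterministic reward-based scheduler maximizes the expected
payoff. -/
theorem exists_optimal_scheduler [Finite Act]
    (hEC : ¬ ∃ (E : Set S) (𝔄 : S → Set Act), M.IsEndComponent E 𝔄)
    {φ : S → ℕ → ℝ≥0∞} {c : ℝ≥0} (hφ : ∀ s r, φ s r ≤ r + c) :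
    ∃ 𝔇 : M.Scheduler, M.IsDeterministic 𝔇 ∧ M.IsRewardBased 𝔇 ∧
      ∀ (s₀ : S) (𝔖 : M.Scheduler), M.payoff 𝔖 s₀ φ ≤ M.payoff 𝔇 s₀ φ := by
  obtain ⟨l, W, hl, hc, hW⟩ := M.exists_geometric_supermartingale hEC c
  -- `W` is a pre-fixed point of the Bellman operator, and `value` is the least one.
  have hVW : M.value φ ≤ fun s r => (W s r : ℝ≥0∞) := by
    refine OrderHom.lfp_le _ fun s r => ?_
    by_cases hs : M.IsTrap s
    · rw [M.bellman_of_trap φ _ hs]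
      exact (hφ s r).trans (by exact_mod_cast hc s r)
    · rw [M.bellman_of_not_trap φ _ hs]
      refine iSup_le fun α => (hW s r α).trans ?_
      exact mul_le_of_le_one_left zero_le (by exact_mod_cast hl.le)
  have hgreedy : ∀ (s : S) (r : ℕ), ¬ M.IsTrap s →
      ∃ α : M.ActAt s, M.qValue (M.value φ) s r α = M.value φ s r := by
    intro s r hs
    have : Nonempty (M.ActAt s) := by
      simp only [IsTrap, not_forall, not_not] at hs
      exact hs.elim fun α h => ⟨⟨α, h⟩⟩
    rw [M.value_of_not_trap φ hs]
    exact exists_eq_ciSup_of_finite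
  choose D hD using hgreedy
  refine ⟨fun s₀ s π hs => PMF.pure (D s π.reward hs), fun s₀ s π hs => ⟨_, rfl⟩,
    fun s₀ s₀' s π π' hs h => by simp only [h], fun s₀ 𝔖 => ?_⟩
  refine (M.payoff_le_value 𝔖 s₀ φ).trans ?_
  set 𝔇 : M.Scheduler := fun s₀ s π hs => PMF.pure (D s π.reward hs) with h𝔇
  have hpay : M.payoff 𝔇 s₀ (M.value φ) = M.payoff 𝔇 s₀ φ := by
    have : M.trapPart (M.value φ) = M.trapPart φ := by
      funext s r
      by_cases h : M.IsTrap s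
      · simp [trapPart, h, M.value_of_trap φ h]
      · simp [trapPart, h]
    rw [payoff, this, payoff]
  rw [← hpay]
  -- Under greedy choices the expectation of `value` is constant in `n`.
  refine M.le_payoff_of_forall_le_expAt 𝔇 s₀ hl hW hVW fun n => le_of_eq ?_
  induction n with
  | zero => rw [expAt_zero]
  | succ n ih =>
    rw [ih, expAt_succ]
    refine lintegral_congr fun ω => ?_
    by_cases h : M.IsTrap (ω n).1
    · rw [M.lintegral_step_of_trap 𝔇 s₀ _ _ h]
    · rw [M.lintegral_step_of_not_trap 𝔇 s₀ _ _ h, onPath, ← hD _ _ h,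
        tsum_eq_single (D (ω n).1 (ω n).2.reward h)]
      · simp [h𝔇]
      · intro α hα
        simp [h𝔇, hα]

end MDP

/-! ### From conditional expectations to payoffs. -/

namespace MDP

variable {S Act : Type*} [Fintype S] (M : MDP S Act)

variable (𝔖 : M.Scheduler) (s₀ : S)

theorem measurableSet_reach (F : Set S) : MeasurableSet (M.reach s₀ F) := by
  have : M.reach s₀ F = ⋃ n, (fun ω : M.Run s₀ => ω n) ⁻¹' {π | π.1 ∈ F} := by
    ext ω; simp [reach]
  rw [this]
  exact MeasurableSet.iUnion fun n => measurable_pi_apply n MeasurableSpace.measurableSet_top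

open Classical in
/-- The payoff `g` of the reward accumulated on reaching the trap `goal`. -/
noncomputable def goalPayoff (goal : S) (g : ℕ → ℝ≥0∞) (s : S) (r : ℕ) : ℝ≥0∞ :=
  if s = goal then g r else 0

-- Once `goal` is hit, state and reward are almost surely frozen. Monotone convergence moves the
-- supremum inside the integral, where it is the value at the hitting time.
open Classical in
theorem payoff_goalPayoff {goal : S} (hgoal : M.IsTrap goal) (g : ℕ → ℝ≥0∞) :
    M.payoff 𝔖 s₀ (goalPayoff goal g) =
      ∫⁻ ω, (if h : ∃ n, (ω n).1 ∈ ({goal} : Set S) then g (ω (Nat.find h)).2.reward else 0)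
        ∂M.Pr 𝔖 s₀ := by
  have htrap : M.trapPart (goalPayoff goal g) = goalPayoff goal g := by
    funext s r
    by_cases h : s = goal
    · subst h; simp [trapPart, hgoal]
    · simp [trapPart, goalPayoff, h]
  simp only [payoff, htrap, expAt]
  have hstay : ∀ᵐ ω ∂M.Pr 𝔖 s₀, ∀ m n, m ≤ n → (ω m).1 = goal →
      (ω n).1 = goal ∧ (ω n).2.reward = (ω m).2.reward := by
    filter_upwards [M.ae_trap_stays 𝔖 s₀] with ω hω m n hmn hm
    induction n, hmn using Nat.le_induction with
    | base => exact ⟨hm, rfl⟩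
    | succ n _ ih =>
      obtain ⟨h1, h2⟩ := hω n (ih.1 ▸ hgoal)
      exact ⟨h1.trans ih.1, h2.trans ih.2⟩
  have hmono : ∀ᵐ ω ∂M.Pr 𝔖 s₀, Monotone fun n => M.onPath (goalPayoff goal g) (ω n) := by
    filter_upwards [hstay] with ω hω m n hmn
    by_cases hm : (ω m).1 = goal
    · obtain ⟨h1, h2⟩ := hω m n hmn hm
      simp [onPath, goalPayoff, hm, h1, h2]
    · simp [onPath, goalPayoff, hm]
  rw [← lintegral_iSup' (fun n => (M.measurable_onPath s₀ _ n).aemeasurable) hmono]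
  refine lintegral_congr_ae ?_
  filter_upwards [hstay] with ω hω
  by_cases h : ∃ n, (ω n).1 ∈ ({goal} : Set S)
  · rw [dif_pos h]
    have hfind : (ω (Nat.find h)).1 = goal := Nat.find_spec h
    refine le_antisymm (iSup_le fun n => ?_) (le_iSup_of_le (Nat.find h) ?_)
    · by_cases hn : (ω n).1 = goal
      · have := (hω _ _ (Nat.find_min' h hn) hfind).2
        simp [onPath, goalPayoff, hn, this]
      · simp [onPath, goalPayoff, hn]
    · rw [onPath, goalPayoff, if_pos hfind]
  · rw [dif_neg h]
    push Not at h
    simp only [Set.mem_singleton_iff] at h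
    simp [onPath, goalPayoff, h]

theorem Pr_reach_eq_payoff {goal : S} (hgoal : M.IsTrap goal) :
    M.Pr 𝔖 s₀ (M.reach s₀ {goal}) = M.payoff 𝔖 s₀ (goalPayoff goal fun _ => 1) := by
  classical
  rw [M.payoff_goalPayoff 𝔖 s₀ hgoal, ← lintegral_indicator_one (M.measurableSet_reach s₀ {goal})]
  refine lintegral_congr fun ω => ?_
  simp [Set.indicator_apply, reach]

theorem setLIntegral_accReward_eq_payoff {goal : S} (hgoal : M.IsTrap goal) :
    ∫⁻ ω in M.reach s₀ {goal}, M.accReward s₀ {goal} ω ∂M.Pr 𝔖 s₀ =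
      M.payoff 𝔖 s₀ (goalPayoff goal fun r => r) := by
  classical
  rw [M.payoff_goalPayoff 𝔖 s₀ hgoal, ← lintegral_indicator (M.measurableSet_reach s₀ {goal})]
  refine lintegral_congr fun ω => ?_
  by_cases h : ∃ n, (ω n).1 ∈ ({goal} : Set S)
  · rw [Set.indicator_of_mem (show ω ∈ M.reach s₀ {goal} from h), accReward, dif_pos h, dif_pos h]
    congr!
  · rw [Set.indicator_of_notMem (show ω ∉ M.reach s₀ {goal} from h), dif_neg h]

theorem coe_lt_cexp_iff {goal : S} (hgoal : M.IsTrap goal)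
    (hpos : 0 < M.Pr 𝔖 M.init (M.reach M.init {goal})) (θ : ℝ≥0) :
    (θ : ℝ≥0∞) < M.cexp {goal} {goal} 𝔖 ↔
      θ * M.payoff 𝔖 M.init (goalPayoff goal fun _ => 1) <
        M.payoff 𝔖 M.init (goalPayoff goal fun r => r) := by
  rw [cexp, ProbabilityTheory.cond, lintegral_smul_measure,
    M.setLIntegral_accReward_eq_payoff 𝔖 _ hgoal, ← M.Pr_reach_eq_payoff 𝔖 _ hgoal, smul_eq_mul,
    mul_comm _ (M.payoff _ _ _), ← div_eq_mul_inv,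
    ENNReal.lt_div_iff_mul_lt (Or.inl hpos.ne') (Or.inl (measure_ne_top _ _))]

open Classical in
/-- The accumulated reward at `goal` and `θ` elsewhere. -/
noncomputable def shiftedPayoff (goal : S) (θ : ℝ≥0) (s : S) (r : ℕ) : ℝ≥0∞ :=
  if s = goal then r else θ

/-- Pointwise, the shifted payoff plus `θ` at `goal` equals the reward at `goal` plus the constant
`θ`. The constant has payoff `θ` by `payoff_one`, and the finite terms cancel. -/
theorem coe_lt_payoff_shiftedPayoff_iff [Finite Act]
    (hEC : ¬ ∃ (E : Set S) (𝔄 : S → Set Act), M.IsEndComponent E 𝔄) (goal : S) (θ : ℝ≥0) :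
    (θ : ℝ≥0∞) < M.payoff 𝔖 s₀ (shiftedPayoff goal θ) ↔
      θ * M.payoff 𝔖 s₀ (goalPayoff goal fun _ => 1) <
        M.payoff 𝔖 s₀ (goalPayoff goal fun r => r) := by
  have hle : M.payoff 𝔖 s₀ (goalPayoff goal fun _ => 1) ≤ 1 := by
    refine le_trans ?_ (M.payoff_one 𝔖 s₀ hEC).le
    refine iSup_mono fun n => M.expAt_mono 𝔖 s₀ (fun s r => ?_) n
    by_cases h : M.IsTrap s <;> by_cases h' : s = goal <;> simp [trapPart, goalPayoff, h, h']
  have hne : θ * M.payoff 𝔖 s₀ (goalPayoff goal fun _ => 1) ≠ ∞ :=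
    ENNReal.mul_ne_top ENNReal.coe_ne_top (ne_top_of_le_ne_top ENNReal.one_ne_top hle)
  have hsum : M.payoff 𝔖 s₀ (shiftedPayoff goal θ) +
      θ * M.payoff 𝔖 s₀ (goalPayoff goal fun _ => 1) =
      M.payoff 𝔖 s₀ (goalPayoff goal fun r => r) + θ := by
    have h1 : M.payoff 𝔖 s₀ (fun _ _ => (θ : ℝ≥0∞) * 1) = θ := by
      rw [M.payoff_const_mul 𝔖 s₀ θ (fun _ _ => 1), M.payoff_one 𝔖 s₀ hEC, mul_one]
    rw [← payoff_const_mul, ← payoff_add]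
    conv_rhs => rw [← h1, ← payoff_add]
    congr 1
    funext s r
    by_cases h : s = goal <;> simp [shiftedPayoff, goalPayoff, h]
  rw [← ENNReal.add_lt_add_iff_right hne, hsum, add_comm, ENNReal.add_lt_add_iff_right
    ENNReal.coe_ne_top]

end MDP

/-- Deterministic reward-based schedulers suffice to approximate the maximal conditional expectation.
For each `θ`, a scheduler exceeds `θ` iff its expected `shiftedPayoff` does, and the latter is
maximized by a deterministic reward-based scheduler. The argument only needs that `goal` is a trap
and that there are no end components; for an infinite supremum it shows that both sides are `⊤`. -/
theorem mainTheorem7 {S Act : Type*} [Fintype S] [Fintype Act] (M : MDP S Act) (goal fail : S)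
    (goal_trap : M.IsTrap goal) (fail_trap : M.IsTrap fail)
    (A1 : ∀ s, IsEmpty (M.PathTo s goal) ↔ s = fail)
    (A2 : ¬ ∃ (E : Set S) (𝔄 : S → Set Act), M.IsEndComponent E 𝔄)
    (hfin : M.cexpMax {goal} {goal} < ⊤) :
    M.cexpMax {goal} {goal} =
      sSup {x : EReal | ∃ 𝔖 : M.Scheduler, M.IsDeterministic 𝔖 ∧ M.IsRewardBased 𝔖 ∧
        0 < M.Pr 𝔖 M.init (M.reach M.init {goal}) ∧ x = (M.cexp {goal} {goal} 𝔖 : EReal)} := by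
  refine le_antisymm (sSup_le ?_) (sSup_le_sSup ?_)
  · rintro _ ⟨𝔖, hpos, -, rfl⟩
    set b : EReal := sSup {x : EReal | ∃ 𝔖 : M.Scheduler, M.IsDeterministic 𝔖 ∧
      M.IsRewardBased 𝔖 ∧ 0 < M.Pr 𝔖 M.init (M.reach M.init {goal}) ∧
        x = (M.cexp {goal} {goal} 𝔖 : EReal)} with hb
    -- The set must be nonempty, as `sSup ∅ = ⊥`: a scheduler maximizing the probability of `◇goal`
    -- belongs to it.
    have hb0 : 0 ≤ b := by
      obtain ⟨𝔇, hdet, hrew, hopt⟩ := M.exists_optimal_scheduler A2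
        (φ := MDP.goalPayoff goal fun _ => 1) (c := 1) fun s r => by
          by_cases h : s = goal <;> simp [MDP.goalPayoff, h]
      have h := hopt M.init 𝔖
      rw [← M.Pr_reach_eq_payoff _ _ goal_trap, ← M.Pr_reach_eq_payoff _ _ goal_trap] at h
      exact (EReal.coe_ennreal_nonneg _).trans
        (le_sSup ⟨𝔇, hdet, hrew, hpos.trans_le h, rfl⟩)
    rw [← EReal.coe_toENNReal hb0, EReal.coe_ennreal_le_coe_ennreal_iff]
    refine ENNReal.le_of_forall_nnreal_lt fun θ hθ => ?_
    rw [M.coe_lt_cexp_iff 𝔖 goal_trap hpos,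
      ← M.coe_lt_payoff_shiftedPayoff_iff 𝔖 M.init A2] at hθ
    obtain ⟨𝔇, hdet, hrew, hopt⟩ := M.exists_optimal_scheduler A2
      (φ := MDP.shiftedPayoff goal θ) (c := θ) fun s r => by
        by_cases h : s = goal <;> simp [MDP.shiftedPayoff, h]
    have hD := hθ.trans_le (hopt M.init 𝔖)
    rw [M.coe_lt_payoff_shiftedPayoff_iff 𝔇 M.init A2] at hD
    -- If `◇goal` were null, the right side of the strict inequality `hD` would be `0`.
    have hDpos : 0 < M.Pr 𝔇 M.init (M.reach M.init {goal}) := by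
      refine pos_iff_ne_zero.2 fun h0 => ?_
      rw [← M.setLIntegral_accReward_eq_payoff 𝔇 _ goal_trap,
        setLIntegral_measure_zero _ _ h0] at hD
      exact not_lt_zero hD
    rw [← M.coe_lt_cexp_iff 𝔇 goal_trap hDpos] at hD
    rw [← EReal.coe_ennreal_le_coe_ennreal_iff, EReal.coe_toENNReal hb0]
    exact le_trans (EReal.coe_ennreal_le_coe_ennreal_iff.2 hD.le)
      (le_sSup ⟨𝔇, hdet, hrew, hDpos, rfl⟩)
  · rintro _ ⟨𝔖, -, -, hpos, rfl⟩
    exact ⟨𝔖, hpos, cond_apply_self hpos.ne' (measure_ne_top _ _), rfl⟩
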